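/- **Theorem.** Let $d,m,R,K\in\mathbb N$ with $K\ge 1$, let $A\in\mathbb C^{m\times d}$ and $\varepsilon>0$, and let $y\in\mathbb R^m$ satisfy $y_j+\varepsilon\ge 0$ for all $j$. Define $$\mathcal L_\varepsilon(z)=\big\|\sqrt{|Az|^2+\varepsilon}-\sqrt{y+\varepsilon}\,\big\|_2^2=\sum_{j=1}^m\Big(\sqrt{|(Az)_j|^2+\varepsilon}-\sqrt{y_j+\varepsilon}\Big)^2,\qquad z\in\mathbb C^d .$$ Divide the rows of $A$ into $R$ blocks $A_1,\dots,A_R$ (a block may be empty), let $y^1,\dots,y^R$ be the corresponding parts of $y$, and set $\mathcal L_{\varepsilon,r}(z)=\|\sqrt{|A_rz|^2+\varepsilon}-\sqrt{y^r+\varepsilon}\|_2^2$, so that $\mathcal L_\varepsilon=\sum_{r=1}^R\mathcal L_{\varepsilon,r}$. For a real-valued function $f$ of $z_j=\alpha_j+i\beta_j$, $j=1,\dots,d$, let $\nabla_z f$ be its Wirtinger gradient, i.e. the vector with entries $\overline{\partial f/\partial z_j}$, where $\frac{\partial f}{\partial z_j}=\frac12\big(\frac{\partial f}{\partial\alpha_j}-i\frac{\partial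 f}{\partial\beta_j}\big)$. Let $p_1,\dots,p_R>0$ with $\sum_{r=1}^R p_r=1$, and let $r^t_k$ ($t\ge 0$, $1\le k\le K$) be independent random variables on a probability space with values in $\{1,\dots,R\}$ and $\mathbb P(r^t_k=r)=p_r$ for all $t,k,r$. For an arbitrary $z^0\in\mathbb C^d$, let the Stochastic Amplitude Flow iterates be $$z^{t+1}=z^t-\mu_t\, g_\varepsilon(z^t),\qquad g_\varepsilon(z^t)=\frac1K\sum_{k=1}^K\frac1{p_{r^t_k}}\nabla_z\mathcal L_{\varepsilon,r^t_k}(z^t),\qquad t\ge 0 .$$ Suppose that the step sizes $\mu_t$ are positive and satisfy $$\sum_{t=0}^\infty\mu_t=\infty,\qquad \sum_{t=0}^\infty\mu_t^2<\infty,\qquad \Big(1-\frac1K\Big)\|A\|^2\mu_t\le 1\ \text{ for all } t\ge 0,$$ where $\|A\|$ is the spectral norm of $A$. Then $$\lim_{t\to\infty}\|\nabla_z\mathcal L_\varepsilon(z^t)\|_2=0\quad\text{almost surely.}$$ -/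

import Mathlib

open MeasureTheory ProbabilityTheory Filter Topology

namespace SAF

noncomputable section

/-- The Wirtinger derivative `∂f/∂z_j = (1/2) (∂f/∂α_j - i ∂f/∂β_j)` at `z`, with `z_j = α_j + i β_j`,
of a real-valued function `f` on `ℂ^d`. -/
def wirtingerDeriv {d : ℕ} (f : EuclideanSpace ℂ (Fin d) → ℝ) (z : EuclideanSpace ℂ (Fin d))
    (j : Fin d) : ℂ :=
  (1 / 2 : ℂ) * ((lineDeriv ℝ f z (EuclideanSpace.single j (1 : ℂ)) : ℝ) : ℂ)
    - (Complex.I / 2) * ((lineDeriv ℝ f z (EuclideanSpace.single j Complex.I) : ℝ) : ℂ)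

/-- The Wirtinger gradient `∇_z f = (∂f/∂z)^*` of a real-valued function on `ℂ^d`. -/
def wirtingerGrad {d : ℕ} (f : EuclideanSpace ℂ (Fin d) → ℝ) (z : EuclideanSpace ℂ (Fin d)) :
    EuclideanSpace ℂ (Fin d) :=
  WithLp.toLp 2 fun j => (starRingEnd ℂ) (wirtingerDeriv f z j)

/-- The smoothed amplitude-based squared loss
`L_ε(z) = ‖√(|Az|² + ε) - √(y + ε)‖₂²`, with rows of `A` indexed by any finite type. -/
def loss {ι : Type*} [Fintype ι] {d : ℕ} (ε : ℝ) (A : Matrix ι (Fin d) ℂ) (y : ι → ℝ)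
    (z : EuclideanSpace ℂ (Fin d)) : ℝ :=
  ∑ j, (Real.sqrt (‖A.mulVec z.ofLp j‖ ^ 2 + ε) - Real.sqrt (y j + ε)) ^ 2

/-- The loss `L_{ε,r}` of the `r`-th row block, where row `j` of `A` belongs to block `blk j`. -/
def blockLoss {m d R : ℕ} (ε : ℝ) (A : Matrix (Fin m) (Fin d) ℂ) (y : Fin m → ℝ)
    (blk : Fin m → Fin R) (r : Fin R) (z : EuclideanSpace ℂ (Fin d)) : ℝ :=
  loss ε (A.submatrix (fun j : {j : Fin m // blk j = r} => (j : Fin m)) id)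
    (fun j : {j : Fin m // blk j = r} => y j) z

/-- The stochastic gradient `(1/K) ∑_k (1/p_{r_k}) ∇_z L_{ε,r_k}(z)` for the sampled block
indices `r_1, …, r_K`. -/
def stochGrad {m d R K : ℕ} (ε : ℝ) (A : Matrix (Fin m) (Fin d) ℂ) (y : Fin m → ℝ)
    (blk : Fin m → Fin R) (p : Fin R → ℝ) (idx : Fin K → Fin R)
    (z : EuclideanSpace ℂ (Fin d)) : EuclideanSpace ℂ (Fin d) :=
  (1 / (K : ℝ)) • ∑ k, (1 / p (idx k)) • wirtingerGrad (blockLoss ε A y blk (idx k)) z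

/-- The iterates `z^{t+1} = z^t - μ_t g_ε(z^t)` of Stochastic Amplitude Flow for the sampled
block indices `idx t k` (iteration `t`, draw `k`). -/
def iterate {m d R K : ℕ} (ε : ℝ) (A : Matrix (Fin m) (Fin d) ℂ) (y : Fin m → ℝ)
    (blk : Fin m → Fin R) (p : Fin R → ℝ) (μ : ℕ → ℝ) (z₀ : EuclideanSpace ℂ (Fin d))
    (idx : ℕ → Fin K → Fin R) : ℕ → EuclideanSpace ℂ (Fin d)
  | 0 => z₀
  | t + 1 =>
      iterate ε A y blk p μ z₀ idx t
        - μ t • stochGrad ε A y blk p (idx t) (iterate ε A y blk p μ z₀ idx t)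

/-- The spectral norm of a complex matrix: its operator norm for the Euclidean norms. -/
def specNorm {m d : ℕ} (A : Matrix (Fin m) (Fin d) ℂ) : ℝ :=
  ‖LinearMap.toContinuousLinearMap (Matrix.toEuclideanLin A)‖

end

end SAF

/-! Write L for the loss. As w ↦ √(|w|² + ε) is convex, a step h raises L by at most 2 Re⟨∇L, h⟩ +
B‖h‖², with B the squared Frobenius norm of A (`loss_add_le`). The stochastic gradient g is
unbiased, and ‖g‖² ≤ C² L for every outcome of the draws (`exists_norm_stochGrad_le`). Hence,
conditionally on the past, E[L(z^{t+1})] ≤ (1 + B C² μ_t²) L(z^t) - 2 μ_t ‖∇L(z^t)‖².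

Since ∑ μ_t² < ∞, the products Q_t of the growth factors stay bounded, and L(z^t)/Q_t is a
nonnegative supermartingale. By `ae_tendsto_and_summable` it converges almost surely and ∑ μ_t
‖∇L(z^t)‖² < ∞.

With ∑ μ_t = ∞ this alone yields only liminf ‖∇L(z^t)‖ = 0. But along almost every path L is
bounded, so g is bounded; as ∇L is Lipschitz, ‖∇L(z^t)‖ grows by at most O(μ_t) per step.
`tendsto_zero_of_summable_mul_sq` then rules out oscillation. -/

namespace SAF

/-! ### A deterministic lemma on real sequences. -/

/-- If `∑ μ t = ∞`, `∑ μ t * a t ^ 2 < ∞`, `μ t → 0` and the increments of `a` are at most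
`M * μ t`, then `a t → 0`. -/
theorem tendsto_zero_of_summable_mul_sq {a μ : ℕ → ℝ} {M : ℝ} (ha : ∀ t, 0 ≤ a t)
    (hμ : ∀ t, 0 < μ t) (hM : 0 ≤ M)
    (hμ_sum : Tendsto (fun T : ℕ => ∑ t ∈ Finset.range T, μ t) atTop atTop)
    (hμ_lim : Tendsto μ atTop (𝓝 0)) (hsum : Summable fun t => μ t * a t ^ 2)
    (hstep : ∀ t, a (t + 1) ≤ a t + M * μ t) : Tendsto a atTop (𝓝 0) := by
  have hns : ¬ Summable μ := fun h =>
    not_tendsto_atTop_of_tendsto_nhds h.hasSum.tendsto_sum_nat hμ_sum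
  have key : ∀ δ > 0, ∀ᶠ t in atTop, a t ≤ 3 * δ := by
    intro δ hδ
    have hS := hsum.hasSum.tendsto_sum_nat
    have hC : Tendsto (fun T => ∑ t ∈ Finset.range T, (M / δ ^ 2) * (μ t * a t ^ 2)) atTop
        (𝓝 ((M / δ ^ 2) * ∑' t, μ t * a t ^ 2)) := by
      simpa [Finset.mul_sum] using hS.const_mul (M / δ ^ 2)
    -- The factor `M / δ ^ 2` makes the increment of `S` at least `M * μ t` whenever `a t ≥ δ`.
    set S : ℕ → ℝ := fun T => ∑ t ∈ Finset.range T, (M / δ ^ 2) * (μ t * a t ^ 2) with hSdef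
    set l := (M / δ ^ 2) * ∑' t, μ t * a t ^ 2
    have h1 : ∀ᶠ t in atTop, |S t - l| < δ / 2 := by
      have := (Metric.tendsto_nhds.1 hC) (δ / 2) (by positivity)
      simpa [Real.dist_eq] using this
    have h2 : ∀ᶠ t in atTop, M * μ t < δ := by
      have : Tendsto (fun t => M * μ t) atTop (𝓝 0) := by simpa using hμ_lim.const_mul M
      exact this.eventually_lt_const hδ
    obtain ⟨N, hN⟩ := eventually_atTop.1 (h1.and h2)
    obtain ⟨t₀, ht₀, hat₀⟩ : ∃ t ≥ N, a t < δ := by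
      by_contra! hcon
      apply hns
      refine (summable_nat_add_iff N).1 ?_
      refine Summable.of_nonneg_of_le (fun t => (hμ _).le) (fun t => ?_)
        (((summable_nat_add_iff N).2 hsum).mul_left (1 / δ ^ 2))
      have h := pow_le_pow_left₀ hδ.le (hcon (t + N) (by omega)) 2
      have := mul_le_mul_of_nonneg_left h (hμ (t + N)).le
      rw [div_mul_eq_mul_div, le_div_iff₀ (by positivity)]
      linarith
    -- From below `δ`, one step leads at most to `2 * δ`; from above `δ`, any growth of `a` is paid
    -- for by the growth of `S`, which after `N` is less than `δ` in total.
    have inv : ∀ t ≥ t₀, a t ≤ 2 * δ + (S t - S t₀) := by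
      intro t ht
      induction t, ht using Nat.le_induction with
      | base => linarith
      | succ t ht ih =>
        have hSs : S (t + 1) = S t + (M / δ ^ 2) * (μ t * a t ^ 2) := by
          simp [hSdef, Finset.sum_range_succ]
        have hmono : S t₀ ≤ S t := by
          refine Finset.sum_le_sum_of_subset_of_nonneg (Finset.range_mono ht) fun i _ _ => ?_
          have := (hμ i).le
          positivity
        have hnn : 0 ≤ (M / δ ^ 2) * (μ t * a t ^ 2) := by
          have := (hμ t).le
          positivity
        have hst := hstep t
        rcases lt_or_ge (a t) δ with hlt | hge
        · have := (hN t (ht₀.trans ht)).2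
          linarith
        · have h := pow_le_pow_left₀ hδ.le hge 2
          have : M * μ t ≤ (M / δ ^ 2) * (μ t * a t ^ 2) := by
            rw [div_mul_eq_mul_div, le_div_iff₀ (by positivity), mul_assoc]
            exact mul_le_mul_of_nonneg_left (mul_le_mul_of_nonneg_left h (hμ t).le) hM
          linarith
    filter_upwards [eventually_ge_atTop t₀] with t ht
    have e1 := abs_lt.1 (hN t (ht₀.trans ht)).1
    have e2 := abs_lt.1 (hN t₀ ht₀).1
    linarith [inv t ht]
  rw [Metric.tendsto_nhds]
  intro e he
  filter_upwards [key (e / 4) (by positivity)] with t ht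
  rw [Real.dist_eq, sub_zero, abs_of_nonneg (ha t)]
  linarith

/-! ### Closed form, descent and Lipschitz estimates for the gradient. -/

section Gradient

variable {ι : Type*} {d : ℕ}

/-- The conjugate of the `j`-th row of `A`, so that `⟪row A j, z⟫ = (A z)_j`. -/
noncomputable def row (A : Matrix ι (Fin d) ℂ) (j : ι) : EuclideanSpace ℂ (Fin d) :=
  WithLp.toLp 2 fun i => (starRingEnd ℂ) (A j i)

theorem inner_row (A : Matrix ι (Fin d) ℂ) (j : ι) (z : EuclideanSpace ℂ (Fin d)) :
    inner ℂ (row A j) z = A.mulVec z.ofLp j := by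
  simp [row, PiLp.inner_apply, Matrix.mulVec, dotProduct, mul_comm]

/-- The derivative coefficient `(1 - c / √(|w|² + ε)) w` of `(√(|w|² + ε) - c)²`. -/
noncomputable def coef (ε c : ℝ) (w : ℂ) : ℂ :=
  ((1 - c / Real.sqrt (‖w‖ ^ 2 + ε) : ℝ) : ℂ) * w

variable [Fintype ι]

/-- The closed form of the Wirtinger gradient of `loss ε A y`. -/
noncomputable def lossGrad (ε : ℝ) (A : Matrix ι (Fin d) ℂ) (y : ι → ℝ)
    (z : EuclideanSpace ℂ (Fin d)) : EuclideanSpace ℂ (Fin d) :=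
  ∑ j, coef ε (Real.sqrt (y j + ε)) (inner ℂ (row A j) z) • row A j

theorem re_inner_lossGrad (ε : ℝ) (A : Matrix ι (Fin d) ℂ) (y : ι → ℝ)
    (z v : EuclideanSpace ℂ (Fin d)) :
    (inner ℂ (lossGrad ε A y z) v).re =
      ∑ j, (inner ℂ (coef ε (Real.sqrt (y j + ε)) (inner ℂ (row A j) z))
        (inner ℂ (row A j) v)).re := by
  simp [lossGrad]

theorem norm_add_smul_sq (w u : ℂ) (t : ℝ) :
    ‖w + t * u‖ ^ 2 = ‖w‖ ^ 2 + 2 * (inner ℂ w u).re * t + ‖u‖ ^ 2 * t ^ 2 := by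
  simp only [← Complex.normSq_eq_norm_sq, Complex.normSq_apply, RCLike.inner_apply]
  simp
  ring

theorem re_inner_coef (ε c : ℝ) (w u : ℂ) :
    (inner ℂ (coef ε c w) u).re = (1 - c / Real.sqrt (‖w‖ ^ 2 + ε)) * (inner ℂ w u).re := by
  simp only [coef, RCLike.inner_apply, map_mul, Complex.conj_ofReal]
  rw [mul_left_comm, Complex.re_ofReal_mul]

theorem hasDerivAt_sqrt_sub_sq {ε : ℝ} (hε : 0 < ε) (c : ℝ) (w u : ℂ) :
    HasDerivAt (fun t : ℝ => (Real.sqrt (‖w + t * u‖ ^ 2 + ε) - c) ^ 2)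
      (2 * (inner ℂ (coef ε c w) u).re) 0 := by
  have hpos : 0 < ‖w‖ ^ 2 + ε := by positivity
  have hs : 0 < Real.sqrt (‖w‖ ^ 2 + ε) := Real.sqrt_pos.2 hpos
  simp_rw [norm_add_smul_sq]
  have h1 : HasDerivAt (fun t : ℝ => ‖w‖ ^ 2 + 2 * (inner ℂ w u).re * t + ‖u‖ ^ 2 * t ^ 2 + ε)
      (2 * (inner ℂ w u).re) 0 := by
    have := ((((hasDerivAt_id (0 : ℝ)).const_mul (2 * (inner ℂ w u).re)).const_add
      (‖w‖ ^ 2)).add (((hasDerivAt_id (0 : ℝ)).pow 2).const_mul (‖u‖ ^ 2))).add_const ε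
    exact HasDerivAt.congr_deriv this (by simp)
  have h2 := ((h1.sqrt (by simpa using hpos.ne')).sub_const c).pow 2
  refine HasDerivAt.congr_deriv h2 ?_
  rw [re_inner_coef]
  simp
  field_simp

theorem hasLineDerivAt_loss {ε : ℝ} (hε : 0 < ε) (A : Matrix ι (Fin d) ℂ) (y : ι → ℝ)
    (z v : EuclideanSpace ℂ (Fin d)) :
    HasLineDerivAt ℝ (loss ε A y) (2 * (inner ℂ (lossGrad ε A y z) v).re) z v := by
  unfold HasLineDerivAt
  rw [re_inner_lossGrad, Finset.mul_sum]
  have : (fun t : ℝ => loss ε A y (z + t • v)) = fun t : ℝ => ∑ j,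
      (Real.sqrt (‖inner ℂ (row A j) z + t * inner ℂ (row A j) v‖ ^ 2 + ε)
        - Real.sqrt (y j + ε)) ^ 2 := by
    funext t
    unfold loss
    refine Finset.sum_congr rfl fun j _ => ?_
    rw [← inner_row, inner_add_right, inner_smul_right_eq_smul, Complex.real_smul]
  rw [this]
  exact HasDerivAt.fun_sum fun j _ => hasDerivAt_sqrt_sub_sq hε _ _ _

/-- The directions e_j and i e_j recover the real and imaginary parts of the `j`-th entry; the
factor 2 of the real derivative cancels the 1/2 in the Wirtinger derivative. -/
theorem wirtingerGrad_loss {ε : ℝ} (hε : 0 < ε) (A : Matrix ι (Fin d) ℂ) (y : ι → ℝ) :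
    wirtingerGrad (loss ε A y) = lossGrad ε A y := by
  funext z
  ext j
  unfold wirtingerGrad wirtingerDeriv
  have h : ∀ v, lineDeriv ℝ (loss ε A y) z v = 2 * (inner ℂ (lossGrad ε A y z) v).re := fun v =>
    (hasLineDerivAt_loss hε A y z v).lineDeriv
  simp only [h]
  simp only [EuclideanSpace.inner_single_right]
  have h2 : (starRingEnd ℂ) 2 = 2 := map_ofNat _ 2
  apply Complex.ext
  · simp [h2]
  · simp [h2]
    ring

/-- The descent inequality; it holds because `w ↦ √(|w|² + ε)` is convex. -/
theorem sqrt_sub_sq_add_le {ε : ℝ} (hε : 0 < ε) {c : ℝ} (hc : 0 ≤ c) (w u : ℂ) :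
    (Real.sqrt (‖w + u‖ ^ 2 + ε) - c) ^ 2 ≤
      (Real.sqrt (‖w‖ ^ 2 + ε) - c) ^ 2 + 2 * (inner ℂ (coef ε c w) u).re + ‖u‖ ^ 2 := by
  have hn := norm_add_smul_sq w u 1
  simp only [Complex.ofReal_one, one_mul, mul_one, one_pow] at hn
  have h1 : 0 < ‖w‖ ^ 2 + ε := by positivity
  have h2 : 0 < ‖w + u‖ ^ 2 + ε := by positivity
  rw [re_inner_coef]
  have hcs : (inner ℂ w u).re ^ 2 ≤ ‖w‖ ^ 2 * ‖u‖ ^ 2 := by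
    rw [← mul_pow, ← sq_abs]
    have : |(inner ℂ w u).re| ≤ ‖w‖ * ‖u‖ :=
      (Complex.abs_re_le_norm _).trans (norm_inner_le_norm w u)
    gcongr
  set x := (inner ℂ w u).re
  have hs := Real.sqrt_pos.2 h1
  have hs' := Real.sqrt_nonneg (‖w + u‖ ^ 2 + ε)
  have e1 := Real.sq_sqrt h1.le
  have e2 := Real.sq_sqrt h2.le
  set s := Real.sqrt (‖w‖ ^ 2 + ε)
  set s' := Real.sqrt (‖w + u‖ ^ 2 + ε)
  -- Tangent inequality of the convex function. After squaring it reduces to x² ≤ s²‖u‖², which is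
  -- Cauchy–Schwarz.
  have hle : s + x / s ≤ s' := by
    rw [← sub_nonneg]
    have hx : s + x / s = (s ^ 2 + x) / s := by field_simp
    rw [hx, sub_nonneg, div_le_iff₀ hs]
    refine abs_le_of_sq_le_sq' ?_ (by positivity) |>.2
    rw [mul_pow, e2, hn, e1]
    nlinarith [sq_nonneg ‖u‖]
  have hx : (1 - c / s) * x = x - c * (x / s) := by ring
  have := mul_le_mul_of_nonneg_left hle hc
  nlinarith

theorem loss_add_le {ε : ℝ} (hε : 0 < ε) (A : Matrix ι (Fin d) ℂ) (y : ι → ℝ)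
    (z h : EuclideanSpace ℂ (Fin d)) :
    loss ε A y (z + h) ≤ loss ε A y z + 2 * (inner ℂ (lossGrad ε A y z) h).re
      + (∑ j, ‖row A j‖ ^ 2) * ‖h‖ ^ 2 := by
  rw [re_inner_lossGrad, Finset.mul_sum, Finset.sum_mul]
  unfold loss
  rw [← Finset.sum_add_distrib, ← Finset.sum_add_distrib]
  refine Finset.sum_le_sum fun j _ => ?_
  simp only [← inner_row, inner_add_right]
  refine (sqrt_sub_sq_add_le hε (Real.sqrt_nonneg _) _ _).trans ?_
  rw [← mul_pow]
  gcongr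
  exact norm_inner_le_norm _ _

theorem norm_coef_le {ε : ℝ} (hε : 0 < ε) (c : ℝ) (w : ℂ) :
    ‖coef ε c w‖ ≤ |Real.sqrt (‖w‖ ^ 2 + ε) - c| := by
  have hs : 0 < Real.sqrt (‖w‖ ^ 2 + ε) := Real.sqrt_pos.2 (by positivity)
  have hw : ‖w‖ ≤ Real.sqrt (‖w‖ ^ 2 + ε) := Real.le_sqrt_of_sq_le (by linarith)
  rw [coef, norm_mul, Complex.norm_real, Real.norm_eq_abs]
  have : 1 - c / Real.sqrt (‖w‖ ^ 2 + ε) = (Real.sqrt (‖w‖ ^ 2 + ε) - c)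
      / Real.sqrt (‖w‖ ^ 2 + ε) := by field_simp
  rw [this, abs_div, abs_of_pos hs, div_mul_eq_mul_div, div_le_iff₀ hs]
  gcongr

theorem loss_nonneg (ε : ℝ) (A : Matrix ι (Fin d) ℂ) (y : ι → ℝ)
    (z : EuclideanSpace ℂ (Fin d)) : 0 ≤ loss ε A y z :=
  Finset.sum_nonneg fun _ _ => sq_nonneg _

/-- Bounding the gradient by the loss itself makes the second-order term of a step a multiple of the
loss, hence absorbable into a growth factor. -/
theorem norm_lossGrad_le {ε : ℝ} (hε : 0 < ε) (A : Matrix ι (Fin d) ℂ) (y : ι → ℝ)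
    (z : EuclideanSpace ℂ (Fin d)) :
    ‖lossGrad ε A y z‖ ≤ (∑ j, ‖row A j‖) * Real.sqrt (loss ε A y z) := by
  rw [Finset.sum_mul]
  refine norm_sum_le_of_le _ fun j _ => ?_
  rw [norm_smul, mul_comm]
  gcongr
  refine (norm_coef_le hε _ _).trans (Real.le_sqrt_of_sq_le ?_)
  rw [sq_abs, inner_row]
  exact Finset.single_le_sum (f := fun j => (Real.sqrt (‖A.mulVec z.ofLp j‖ ^ 2 + ε)
    - Real.sqrt (y j + ε)) ^ 2) (fun _ _ => sq_nonneg _) (Finset.mem_univ j)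

theorem abs_sqrt_norm_sq_add_sub_le {ε : ℝ} (hε : 0 < ε) (w u : ℂ) :
    |Real.sqrt (‖w‖ ^ 2 + ε) - Real.sqrt (‖u‖ ^ 2 + ε)| ≤ ‖w - u‖ := by
  have h1 : 0 < ‖w‖ ^ 2 + ε := by positivity
  have h2 : 0 < ‖u‖ ^ 2 + ε := by positivity
  have hs := Real.sqrt_pos.2 h1
  have hs' := Real.sqrt_pos.2 h2
  have e1 := Real.sq_sqrt h1.le
  have e2 := Real.sq_sqrt h2.le
  have hw : ‖w‖ ≤ Real.sqrt (‖w‖ ^ 2 + ε) := Real.le_sqrt_of_sq_le (by linarith)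
  have hu : ‖u‖ ≤ Real.sqrt (‖u‖ ^ 2 + ε) := Real.le_sqrt_of_sq_le (by linarith)
  set s := Real.sqrt (‖w‖ ^ 2 + ε)
  set s' := Real.sqrt (‖u‖ ^ 2 + ε)
  refine le_trans ?_ (abs_norm_sub_norm_le w u)
  have hfac : (s - s') * (s + s') = (‖w‖ - ‖u‖) * (‖w‖ + ‖u‖) := by nlinarith
  have hpos : 0 < s + s' := by positivity
  refine le_of_mul_le_mul_right ?_ hpos
  calc |s - s'| * (s + s') = |(s - s') * (s + s')| := by rw [abs_mul, abs_of_pos hpos]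
    _ = |‖w‖ - ‖u‖| * (‖w‖ + ‖u‖) := by
        rw [hfac, abs_mul, abs_of_nonneg (add_nonneg (norm_nonneg w) (norm_nonneg u))]
    _ ≤ _ := by gcongr

theorem norm_coef_sub_le {ε : ℝ} (hε : 0 < ε) {c : ℝ} (hc : 0 ≤ c) (w u : ℂ) :
    ‖coef ε c w - coef ε c u‖ ≤ (1 + 2 * c / Real.sqrt ε) * ‖w - u‖ := by
  have h1 : 0 < ‖w‖ ^ 2 + ε := by positivity
  have h2 : 0 < ‖u‖ ^ 2 + ε := by positivity
  have hs := Real.sqrt_pos.2 h1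
  have hs' := Real.sqrt_pos.2 h2
  have hu : ‖u‖ ≤ Real.sqrt (‖u‖ ^ 2 + ε) := Real.le_sqrt_of_sq_le (by linarith)
  have hε' : Real.sqrt ε ≤ Real.sqrt (‖w‖ ^ 2 + ε) := Real.sqrt_le_sqrt (by nlinarith [sq_nonneg ‖w‖])
  have hd := abs_sqrt_norm_sq_add_sub_le hε w u
  have hεp := Real.sqrt_pos.2 hε
  unfold coef
  set s := Real.sqrt (‖w‖ ^ 2 + ε)
  set s' := Real.sqrt (‖u‖ ^ 2 + ε)
  have hsC : (s : ℂ) ≠ 0 := by exact_mod_cast hs.ne'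
  have hsC' : (s' : ℂ) ≠ 0 := by exact_mod_cast hs'.ne'
  -- The last term carries the change of the scalar factor, c/s' - c/s; each of the two corrections
  -- costs at most c/√ε · ‖w - u‖.
  have hid : ((1 - c / s : ℝ) : ℂ) * w - ((1 - c / s' : ℝ) : ℂ) * u
      = (w - u) - ((c / s : ℝ) : ℂ) * (w - u) + ((c * (s - s') / (s * s') : ℝ) : ℂ) * u := by
    push_cast
    field_simp
    ring
  have b1 : c / s ≤ c / Real.sqrt ε := by gcongr
  have n1 : ‖((c / s : ℝ) : ℂ) * (w - u)‖ ≤ c / Real.sqrt ε * ‖w - u‖ := by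
    rw [norm_mul, Complex.norm_real, Real.norm_of_nonneg (by positivity)]
    gcongr
  have n2 : ‖((c * (s - s') / (s * s') : ℝ) : ℂ) * u‖ ≤ c / Real.sqrt ε * ‖w - u‖ := by
    rw [norm_mul, Complex.norm_real, Real.norm_eq_abs, abs_div, abs_mul, abs_of_nonneg hc,
      abs_of_pos (mul_pos hs hs')]
    calc c * |s - s'| / (s * s') * ‖u‖ = c / s * |s - s'| * (‖u‖ / s') := by field_simp
      _ ≤ c / Real.sqrt ε * ‖w - u‖ * 1 := by
        gcongr
        exact (div_le_one hs').2 hu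
      _ = _ := mul_one _
  rw [hid]
  calc _ ≤ ‖w - u‖ + ‖((c / s : ℝ) : ℂ) * (w - u)‖
        + ‖((c * (s - s') / (s * s') : ℝ) : ℂ) * u‖ :=
        (norm_add_le _ _).trans (add_le_add_left (norm_sub_le _ _) _)
    _ ≤ ‖w - u‖ + c / Real.sqrt ε * ‖w - u‖ + c / Real.sqrt ε * ‖w - u‖ := by gcongr
    _ = _ := by ring

theorem exists_norm_lossGrad_sub_le {ε : ℝ} (hε : 0 < ε) (A : Matrix ι (Fin d) ℂ) (y : ι → ℝ) :
    ∃ C, 0 ≤ C ∧ ∀ z x, ‖lossGrad ε A y z - lossGrad ε A y x‖ ≤ C * ‖z - x‖ := by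
  refine ⟨∑ j, (1 + 2 * Real.sqrt (y j + ε) / Real.sqrt ε) * ‖row A j‖ * ‖row A j‖,
    Finset.sum_nonneg fun j _ => by positivity, fun z x => ?_⟩
  unfold lossGrad
  rw [← Finset.sum_sub_distrib, Finset.sum_mul]
  refine norm_sum_le_of_le _ fun j _ => ?_
  rw [← sub_smul, norm_smul]
  have h := norm_coef_sub_le hε (Real.sqrt_nonneg (y j + ε)) (inner ℂ (row A j) z)
    (inner ℂ (row A j) x)
  rw [← inner_sub_right] at h
  calc _ ≤ (1 + 2 * Real.sqrt (y j + ε) / Real.sqrt ε) * (‖row A j‖ * ‖z - x‖) * ‖row A j‖ := by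
        gcongr
        exact h.trans (by gcongr; exact norm_inner_le_norm _ _)
    _ = _ := by ring

theorem continuous_lossGrad {ε : ℝ} (hε : 0 < ε) (A : Matrix ι (Fin d) ℂ) (y : ι → ℝ) :
    Continuous (lossGrad ε A y) := by
  obtain ⟨C, hC, h⟩ := exists_norm_lossGrad_sub_le hε A y
  exact (LipschitzWith.of_dist_le_mul (K := ⟨C, hC⟩)
    fun z x => by rw [dist_eq_norm, dist_eq_norm]; exact h z x).continuous

theorem continuous_loss (ε : ℝ) (A : Matrix ι (Fin d) ℂ) (y : ι → ℝ) :
    Continuous (loss ε A y) := by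
  unfold loss
  simp_rw [← inner_row]
  fun_prop

end Gradient

/-! ### Row blocks and the size of the stochastic gradient. -/

section Blocks

variable {m d R : ℕ}

theorem sum_blockGrad {ε : ℝ} (hε : 0 < ε) (A : Matrix (Fin m) (Fin d) ℂ) (y : Fin m → ℝ)
    (blk : Fin m → Fin R) (z : EuclideanSpace ℂ (Fin d)) :
    ∑ i, wirtingerGrad (blockLoss ε A y blk i) z = lossGrad ε A y z := by
  have h : ∀ i, wirtingerGrad (blockLoss ε A y blk i) z
      = ∑ j : {j : Fin m // blk j = i},
        coef ε (Real.sqrt (y j + ε)) (inner ℂ (row A j) z) • row A j := fun i =>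
    congrFun (wirtingerGrad_loss hε _ _) z
  simp_rw [h, lossGrad]
  exact Fintype.sum_fiberwise blk fun j =>
    coef ε (Real.sqrt (y j + ε)) (inner ℂ (row A j) z) • row A j

theorem sum_blockLoss (ε : ℝ) (A : Matrix (Fin m) (Fin d) ℂ) (y : Fin m → ℝ)
    (blk : Fin m → Fin R) (z : EuclideanSpace ℂ (Fin d)) :
    ∑ i, blockLoss ε A y blk i z = loss ε A y z :=
  Fintype.sum_fiberwise blk fun j =>
    (Real.sqrt (‖A.mulVec z.ofLp j‖ ^ 2 + ε) - Real.sqrt (y j + ε)) ^ 2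

theorem wirtingerGrad_blockLoss {ε : ℝ} (hε : 0 < ε) (A : Matrix (Fin m) (Fin d) ℂ)
    (y : Fin m → ℝ) (blk : Fin m → Fin R) (i : Fin R) :
    wirtingerGrad (blockLoss ε A y blk i) =
      lossGrad ε (A.submatrix (fun j : {j : Fin m // blk j = i} => (j : Fin m)) id)
        (fun j => y j) :=
  wirtingerGrad_loss hε _ _

theorem continuous_wirtingerGrad_blockLoss {ε : ℝ} (hε : 0 < ε) (A : Matrix (Fin m) (Fin d) ℂ)
    (y : Fin m → ℝ) (blk : Fin m → Fin R) (i : Fin R) :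
    Continuous (wirtingerGrad (blockLoss ε A y blk i)) := by
  rw [wirtingerGrad_blockLoss hε]
  exact continuous_lossGrad hε _ _

theorem exists_norm_stochGrad_le {K : ℕ} {ε : ℝ} (hε : 0 < ε) (A : Matrix (Fin m) (Fin d) ℂ)
    (y : Fin m → ℝ) (blk : Fin m → Fin R) {p : Fin R → ℝ} (hp : ∀ i, 0 < p i) :
    ∃ C, 0 ≤ C ∧ ∀ (idx : Fin K → Fin R) (z : EuclideanSpace ℂ (Fin d)),
      ‖stochGrad ε A y blk p idx z‖ ≤ C * Real.sqrt (loss ε A y z) := by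
  have hB : ∀ i, ∃ C, 0 ≤ C ∧ ∀ z, ‖wirtingerGrad (blockLoss ε A y blk i) z‖
      ≤ C * Real.sqrt (loss ε A y z) := by
    intro i
    refine ⟨∑ j : {j : Fin m // blk j = i}, ‖row (A.submatrix (fun j : {j : Fin m // blk j = i} =>
      (j : Fin m)) id) j‖, Finset.sum_nonneg fun j _ => norm_nonneg _, fun z => ?_⟩
    rw [wirtingerGrad_blockLoss hε]
    refine (norm_lossGrad_le hε _ _ z).trans ?_
    gcongr
    rw [← sum_blockLoss ε A y blk z]
    exact Finset.single_le_sum (f := fun i => blockLoss ε A y blk i z)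
      (fun _ _ => loss_nonneg _ _ _ _) (Finset.mem_univ i)
  choose C hC hb using hB
  have hnn : ∀ i, 0 ≤ 1 / p i * C i := fun i => mul_nonneg (one_div_pos.2 (hp i)).le (hC i)
  refine ⟨(1 / (K : ℝ)) * ∑ _k : Fin K, ∑ i, 1 / p i * C i, by
    have := Finset.sum_nonneg fun i (_ : i ∈ Finset.univ) => hnn i
    positivity, fun idx z => ?_⟩
  rw [stochGrad, norm_smul, Real.norm_of_nonneg (by positivity), mul_assoc, Finset.sum_mul]
  gcongr
  refine norm_sum_le_of_le _ fun k _ => ?_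
  rw [norm_smul, Real.norm_of_nonneg (one_div_pos.2 (hp _)).le]
  calc _ ≤ 1 / p (idx k) * (C (idx k) * Real.sqrt (loss ε A y z)) := by
        have := (one_div_pos.2 (hp (idx k))).le
        gcongr
        exact hb _ z
    _ = (1 / p (idx k) * C (idx k)) * Real.sqrt (loss ε A y z) := by ring
    _ ≤ _ := by
        gcongr
        exact Finset.single_le_sum (f := fun i => 1 / p i * C i) (fun i _ => hnn i)
          (Finset.mem_univ (idx k))

end Blocks

end SAF

namespace SAF

/-! ### Random indices, almost sure convergence and the filtration of the draws. -/

section Probability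

/-- Expectation of a quantity that depends on a random index independent of `m`. -/
theorem setIntegral_random_index {Ω : Type*} {m : MeasurableSpace Ω} [mΩ : MeasurableSpace Ω]
    {P : Measure Ω} [IsProbabilityMeasure P] {R : ℕ} (hm : m ≤ mΩ) {ρ : Ω → Fin R} (hρ : Measurable ρ)
    (hind : Indep m (MeasurableSpace.comap ρ inferInstance) P) {p : Fin R → ℝ}
    (hp : ∀ i, 0 < p i) (hlaw : ∀ i, P.real {ω | ρ ω = i} = p i) {f : Fin R → Ω → ℝ}
    (hf : ∀ i, Measurable[m] (f i)) (hfint : ∀ i, Integrable (f i) P) {s : Set Ω}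
    (hs : MeasurableSet[m] s) :
    ∫ ω in s, 1 / p (ρ ω) * f (ρ ω) ω ∂P = ∫ ω in s, ∑ i, f i ω ∂P := by
  have hset : ∀ i, MeasurableSet {ω | ρ ω = i} := fun i => hρ (measurableSet_singleton i)
  have hone : ∀ i, ∫ ω in s, {ω | ρ ω = i}.indicator (fun _ => (1 : ℝ)) ω * f i ω ∂P
      = p i * ∫ ω in s, f i ω ∂P := by
    intro i
    -- Restriction to `s` is moved onto `f i`, so that the integral becomes the expectation of a
    -- product of two independent variables.
    have hY : Measurable[m] (s.indicator (f i)) := (hf i).indicator hs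
    have hI : IndepFun ({ω | ρ ω = i}.indicator (fun _ => (1 : ℝ))) (s.indicator (f i)) P := by
      rw [IndepFun_iff_Indep]
      refine indep_of_indep_of_le_left (indep_of_indep_of_le_right hind.symm hY.comap_le) ?_
      refine Measurable.comap_le ?_
      refine measurable_const.indicator ?_
      exact ⟨{i}, measurableSet_singleton i, rfl⟩
    have h := hI.integral_fun_mul_eq_mul_integral
      (measurable_const.indicator (hset i)).aestronglyMeasurable
      (hY.mono hm le_rfl).aestronglyMeasurable
    rw [integral_indicator (hm s hs), integral_indicator_const _ (hset i), hlaw] at h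
    rw [← integral_indicator (hm s hs)]
    simp only [smul_eq_mul, mul_one] at h
    rw [← h]
    refine integral_congr_ae (ae_of_all _ fun ω => ?_)
    by_cases hω : ω ∈ s <;> simp [hω]
  have hint : ∀ i, Integrable
      (fun ω => {ω | ρ ω = i}.indicator (fun _ => (1 : ℝ)) ω * f i ω) (P.restrict s) := by
    intro i
    have : (fun ω => {ω | ρ ω = i}.indicator (fun _ => (1 : ℝ)) ω * f i ω)
        = {ω | ρ ω = i}.indicator (f i) := by
      funext ω
      by_cases hω : ρ ω = i <;> simp [hω]
    rw [this]
    exact ((hfint i).indicator (hset i)).integrableOn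
  have hsplit : ∀ ω, 1 / p (ρ ω) * f (ρ ω) ω = ∑ i, 1 / p i *
      ({ω | ρ ω = i}.indicator (fun _ => (1 : ℝ)) ω * f i ω) := by
    intro ω
    rw [Finset.sum_eq_single (ρ ω)]
    · simp
    · intro i _ hi
      simp [Ne.symm hi]
    · simp
  simp_rw [hsplit]
  rw [integral_finsetSum _ fun i _ => (hint i).const_mul _,
    integral_finsetSum _ fun i _ => (hfint i).integrableOn]
  refine Finset.sum_congr rfl fun i _ => ?_
  rw [integral_const_mul, hone, ← mul_assoc, one_div_mul_cancel (hp i).ne', one_mul]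

variable {Ω : Type*} [mΩ : MeasurableSpace Ω] {P : Measure Ω}

/-- If `∑ E[X t]` is bounded, nonnegative variables `X t` are a.s. summable. -/
theorem ae_summable_of_sum_integral_le {X : ℕ → Ω → ℝ} (hX : ∀ t ω, 0 ≤ X t ω)
    (hint : ∀ t, Integrable (X t) P) {C : ℝ}
    (hC : ∀ T, ∑ t ∈ Finset.range T, ∫ ω, X t ω ∂P ≤ C) :
    ∀ᵐ ω ∂P, Summable fun t => X t ω := by
  have hm : ∀ t, AEMeasurable (fun ω => ENNReal.ofReal (X t ω)) P := fun t =>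
    (hint t).aemeasurable.ennreal_ofReal
  have hfin : ∫⁻ ω, ∑' t, ENNReal.ofReal (X t ω) ∂P ≠ ⊤ := by
    rw [lintegral_tsum hm]
    refine ne_top_of_le_ne_top ENNReal.ofReal_ne_top (b := ENNReal.ofReal C) ?_
    refine ENNReal.tsum_le_of_sum_range_le fun T => ?_
    rw [Finset.sum_congr rfl fun t _ =>
      (ofReal_integral_eq_lintegral_ofReal (hint t) (ae_of_all _ (hX t))).symm,
      ← ENNReal.ofReal_sum_of_nonneg fun t _ => integral_nonneg (hX t)]
    exact ENNReal.ofReal_le_ofReal (hC T)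
  filter_upwards [ae_lt_top' (AEMeasurable.tsum hm) hfin] with ω hω
  have := ENNReal.summable_toReal hω.ne
  exact this.congr fun t => (ENNReal.toReal_ofReal (hX t ω))

/-- A special case of the Robbins–Siegmund theorem: a nonnegative adapted process `V` with
`E[V (t + 1) | ℱ t] ≤ V t - X t` and `X ≥ 0` is a.s. convergent, and `X` is a.s. summable. -/
theorem ae_tendsto_and_summable [IsProbabilityMeasure P] {ℱ : Filtration ℕ mΩ} {V X : ℕ → Ω → ℝ}
    (hadp : ∀ t, StronglyMeasurable[ℱ t] (V t)) (hV : ∀ t ω, 0 ≤ V t ω) (hX : ∀ t ω, 0 ≤ X t ω)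
    (hVint : ∀ t, Integrable (V t) P) (hXint : ∀ t, Integrable (X t) P)
    (hstep : ∀ t s, MeasurableSet[ℱ t] s →
      ∫ ω in s, V (t + 1) ω ∂P ≤ ∫ ω in s, V t ω ∂P - ∫ ω in s, X t ω ∂P) :
    ∀ᵐ ω ∂P, (∃ c, Tendsto (fun t => V t ω) atTop (𝓝 c)) ∧ Summable fun t => X t ω := by
  have hsup : Supermartingale V ℱ P := by
    refine supermartingale_of_setIntegral_succ_le hadp hVint fun t s hs => ?_
    have := integral_nonneg (μ := P.restrict s) (f := X t) (hX t)
    linarith [hstep t s hs]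
  have hstep' : ∀ t, ∫ ω, V (t + 1) ω ∂P ≤ ∫ ω, V t ω ∂P - ∫ ω, X t ω ∂P := fun t => by
    simpa using hstep t Set.univ MeasurableSet.univ
  have hsum : ∀ T, ∑ t ∈ Finset.range T, ∫ ω, X t ω ∂P ≤ ∫ ω, V 0 ω ∂P - ∫ ω, V T ω ∂P := by
    intro T
    induction T with
    | zero => simp
    | succ T ih =>
      rw [Finset.sum_range_succ]
      linarith [hstep' T]
  have hVle : ∀ T, ∫ ω, V T ω ∂P ≤ ∫ ω, V 0 ω ∂P := fun T => by
    have := Finset.sum_nonneg fun t (_ : t ∈ Finset.range T) => integral_nonneg (μ := P) (f := X t) (hX t)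
    linarith [hsum T]
  -- Nonnegativity turns the bound on expectations into the L¹ bound required for convergence of the
  -- submartingale `-V`.
  have hbdd : ∀ t, eLpNorm ((-V) t) 1 P ≤ (∫ ω, V 0 ω ∂P).toNNReal := by
    intro t
    rw [Pi.neg_apply, eLpNorm_neg, eLpNorm_one_eq_lintegral_enorm,
      ← ofReal_integral_norm_eq_lintegral_enorm (hVint t)]
    refine ENNReal.ofReal_le_ofReal ?_
    simpa only [Real.norm_of_nonneg (hV t _)] using hVle t
  filter_upwards [hsup.neg.exists_ae_tendsto_of_bdd hbdd,
    ae_summable_of_sum_integral_le hX hXint (C := ∫ ω, V 0 ω ∂P)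
      fun T => (hsum T).trans (by linarith [integral_nonneg (μ := P) (f := V T) (hV T)])] with ω h1 h2
  obtain ⟨c, hc⟩ := h1
  exact ⟨⟨-c, by simpa using hc.neg⟩, h2⟩

/-- The information generated by the draws of the iterations before `t`. -/
def drawFiltration {K R : ℕ} {r : ℕ → Fin K → Ω → Fin R} (hr : ∀ t k, Measurable (r t k)) :
    Filtration ℕ mΩ where
  seq t := ⨆ q ∈ {q : ℕ × Fin K | q.1 < t}, MeasurableSpace.comap (r q.1 q.2) inferInstance
  mono' _ _ h := biSup_mono fun _ hq => lt_of_lt_of_le hq h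
  le' _ := iSup₂_le fun q _ => (hr q.1 q.2).comap_le

/-- The filtration at `t` contains only draws of iterations strictly before `t`, an index set
disjoint from `{(t, k)}`. -/
theorem indep_drawFiltration {K R : ℕ} {r : ℕ → Fin K → Ω → Fin R}
    (hr : ∀ t k, Measurable (r t k))
    (hind : iIndepFun (fun (q : ℕ × Fin K) => r q.1 q.2) P) (t : ℕ) (k : Fin K) :
    Indep (drawFiltration hr t) (MeasurableSpace.comap (r t k) inferInstance) P := by
  have h := indep_iSup_of_disjoint (fun q : ℕ × Fin K => (hr q.1 q.2).comap_le) hind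
    (S := {q | q.1 < t}) (T := {(t, k)}) (by simp)
  simp only [Set.mem_singleton_iff, iSup_iSup_eq_left] at h
  exact h

theorem measurable_draw {K R : ℕ} {r : ℕ → Fin K → Ω → Fin R}
    (hr : ∀ t k, Measurable (r t k)) (t : ℕ) (k : Fin K) :
    Measurable[drawFiltration hr (t + 1)] (r t k) :=
  Measurable.of_comap_le (le_iSup₂_of_le (t, k) (Nat.lt_succ_self t) le_rfl)

end Probability

/-! ### Measurability of the iterates and unbiasedness of the stochastic gradient. -/

section Iterates

variable {m d R K : ℕ}

/-- Finitely many draws precede each iteration, so an iterate takes finitely many values; this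
settles integrability without moment estimates. -/
theorem integrable_comp_of_finite_range {Ω : Type*} [MeasurableSpace Ω] {P : Measure Ω}
    {E : Type*} [MeasurableSpace E] [IsFiniteMeasure P]
    {Z : Ω → E} (hZ : Measurable Z) (hfin : (Set.range Z).Finite) {φ : E → ℝ}
    (hφ : Measurable φ) : Integrable (fun ω => φ (Z ω)) P := by
  obtain ⟨C, hC⟩ := ((hfin.image φ).image norm).bddAbove
  refine Integrable.of_bound (hφ.comp hZ).aestronglyMeasurable C (ae_of_all _ fun ω => ?_)
  exact hC ⟨_, ⟨_, ⟨ω, rfl⟩, rfl⟩, rfl⟩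

theorem measurable_iterate {ε : ℝ} (hε : 0 < ε) (A : Matrix (Fin m) (Fin d) ℂ) (y : Fin m → ℝ)
    (blk : Fin m → Fin R) (p : Fin R → ℝ) (μ : ℕ → ℝ) (z₀ : EuclideanSpace ℂ (Fin d))
    {Ω : Type*} [MeasurableSpace Ω] {r : ℕ → Fin K → Ω → Fin R}
    (hr : ∀ t k, Measurable (r t k)) (t : ℕ) :
    Measurable[drawFiltration hr t]
      (fun ω => iterate ε A y blk p μ z₀ (fun s k => r s k ω) t) := by
  induction t with
  | zero => exact measurable_const
  | succ t ih =>
    have ih' := ih.mono ((drawFiltration hr).mono t.le_succ) le_rfl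
    have hG : Measurable (fun q : Fin R × EuclideanSpace ℂ (Fin d) =>
        (1 / p q.1) • wirtingerGrad (blockLoss ε A y blk q.1) q.2) := by
      refine measurable_from_prod_countable_right fun i => ?_
      exact (continuous_wirtingerGrad_blockLoss hε A y blk i).measurable.const_smul (1 / p i)
    have hg : Measurable[drawFiltration hr (t + 1)] fun ω =>
        stochGrad ε A y blk p (fun k => r t k ω)
          (iterate ε A y blk p μ z₀ (fun s k => r s k ω) t) := by
      unfold stochGrad
      exact Measurable.const_smul (Finset.measurable_fun_sum Finset.univ fun k _ =>
        hG.comp ((measurable_draw hr t k).prodMk ih')) (1 / (K : ℝ))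
    exact ih'.sub (hg.const_smul (μ t))

theorem finite_range_iterate (ε : ℝ) (A : Matrix (Fin m) (Fin d) ℂ) (y : Fin m → ℝ)
    (blk : Fin m → Fin R) (p : Fin R → ℝ) (μ : ℕ → ℝ) (z₀ : EuclideanSpace ℂ (Fin d))
    {Ω : Type*} (r : ℕ → Fin K → Ω → Fin R) (t : ℕ) :
    (Set.range fun ω => iterate ε A y blk p μ z₀ (fun s k => r s k ω) t).Finite := by
  induction t with
  | zero => exact (Set.finite_singleton z₀).subset (by rintro _ ⟨ω, rfl⟩; rfl)
  | succ t ih =>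
    refine (Set.Finite.image2 (fun z idx => z - μ t • stochGrad ε A y blk p idx z) ih
      (Set.finite_univ (α := Fin K → Fin R))).subset ?_
    rintro _ ⟨ω, rfl⟩
    exact ⟨_, ⟨ω, rfl⟩, fun k => r t k ω, Set.mem_univ _, rfl⟩

/-- The stochastic gradient is an unbiased estimator of the gradient. -/
theorem integrable_and_setIntegral_inner_stochGrad {Ω : Type*} {m₀ : MeasurableSpace Ω}
    [mΩ : MeasurableSpace Ω] {P : Measure Ω} [IsProbabilityMeasure P] (hK : 1 ≤ K) {ε : ℝ} (hε : 0 < ε)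
    (A : Matrix (Fin m) (Fin d) ℂ) (y : Fin m → ℝ) (blk : Fin m → Fin R) {p : Fin R → ℝ}
    (hp : ∀ i, 0 < p i) (hm₀ : m₀ ≤ mΩ) {ρ : Fin K → Ω → Fin R}
    (hρ : ∀ k, Measurable (ρ k))
    (hind : ∀ k, Indep m₀ (MeasurableSpace.comap (ρ k) inferInstance) P)
    (hlaw : ∀ k i, P.real {ω | ρ k ω = i} = p i) {Z : Ω → EuclideanSpace ℂ (Fin d)}
    (hZ : Measurable[m₀] Z) (hfin : (Set.range Z).Finite) :
    Integrable (fun ω => (inner ℂ (lossGrad ε A y (Z ω))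
        (stochGrad ε A y blk p (fun k => ρ k ω) (Z ω))).re) P ∧
    ∀ s, MeasurableSet[m₀] s → ∫ ω in s, (inner ℂ (lossGrad ε A y (Z ω))
        (stochGrad ε A y blk p (fun k => ρ k ω) (Z ω))).re ∂P
      = ∫ ω in s, ‖lossGrad ε A y (Z ω)‖ ^ 2 ∂P := by
  set φ : Fin R → EuclideanSpace ℂ (Fin d) → ℝ := fun i z =>
    (inner ℂ (lossGrad ε A y z) (wirtingerGrad (blockLoss ε A y blk i) z)).re with hφdef
  have hφ : ∀ i, Measurable (φ i) := by
    intro i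
    exact (Complex.continuous_re.comp ((continuous_lossGrad hε A y).inner
      (continuous_wirtingerGrad_blockLoss hε A y blk i))).measurable
  have hφint : ∀ i, Integrable (fun ω => φ i (Z ω)) P := fun i =>
    integrable_comp_of_finite_range (hZ.mono hm₀ le_rfl) hfin (hφ i)
  have hexp : ∀ ω, (inner ℂ (lossGrad ε A y (Z ω))
        (stochGrad ε A y blk p (fun k => ρ k ω) (Z ω))).re
      = (1 / (K : ℝ)) * ∑ k, 1 / p (ρ k ω) * φ (ρ k ω) (Z ω) := by
    intro ω
    simp only [stochGrad, inner_smul_right_eq_smul, inner_sum, Complex.smul_re, Complex.re_sum,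
      smul_eq_mul, hφdef]
  have hint : ∀ k, Integrable (fun ω => 1 / p (ρ k ω) * φ (ρ k ω) (Z ω)) P := by
    intro k
    have hG : Measurable (fun q : Fin R × EuclideanSpace ℂ (Fin d) => 1 / p q.1 * φ q.1 q.2) :=
      measurable_from_prod_countable_right fun i => (hφ i).const_mul (1 / p i)
    refine integrable_comp_of_finite_range (Z := fun ω => (ρ k ω, Z ω))
      ((hρ k).prodMk (hZ.mono hm₀ le_rfl)) ?_ hG
    refine (Set.Finite.prod (Set.finite_univ (α := Fin R)) hfin).subset ?_
    rintro _ ⟨ω, rfl⟩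
    exact ⟨Set.mem_univ _, ω, rfl⟩
  -- The block gradients add up to the full gradient, so the pairing becomes its squared norm.
  have hsum : ∀ ω, ∑ i, φ i (Z ω) = ‖lossGrad ε A y (Z ω)‖ ^ 2 := by
    intro ω
    simp only [hφdef]
    rw [← Complex.re_sum, ← inner_sum, sum_blockGrad hε, inner_self_eq_norm_sq_to_K]
    norm_cast
  simp_rw [hexp]
  refine ⟨(integrable_finsetSum _ fun k _ => hint k).const_mul _, fun s hs => ?_⟩
  rw [integral_const_mul, integral_finsetSum _ fun k _ => (hint k).integrableOn]
  have hk : ∀ k, ∫ ω in s, 1 / p (ρ k ω) * φ (ρ k ω) (Z ω) ∂P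
      = ∫ ω in s, ‖lossGrad ε A y (Z ω)‖ ^ 2 ∂P := by
    intro k
    rw [setIntegral_random_index (f := fun i ω => φ i (Z ω)) hm₀ (hρ k) (hind k) hp (hlaw k)
      (fun i => (hφ i).comp hZ) hφint hs]
    simp_rw [hsum]
  simp only [hk, Finset.sum_const, Finset.card_univ, Fintype.card_fin, nsmul_eq_mul]
  have : (K : ℝ) ≠ 0 := by positivity
  field_simp

end Iterates

end SAF

/-! ### The convergence theorem. -/

theorem mainTheorem2 {m d R K : ℕ} (hK : 1 ≤ K)
    (A : Matrix (Fin m) (Fin d) ℂ) (y : Fin m → ℝ) (blk : Fin m → Fin R)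
    (ε : ℝ) (hε : 0 < ε) (hy : ∀ j, 0 ≤ y j + ε)
    (p : Fin R → ℝ) (hp_pos : ∀ i, 0 < p i) (hp_sum : ∑ i, p i = 1)
    (μ : ℕ → ℝ) (hμ_pos : ∀ t, 0 < μ t)
    (hμ_sum : Tendsto (fun T : ℕ => ∑ t ∈ Finset.range T, μ t) atTop atTop)
    (hμ_sq : Summable fun t => μ t ^ 2)
    (hμ_le : ∀ t, (1 - 1 / (K : ℝ)) * SAF.specNorm A ^ 2 * μ t ≤ 1)
    (z₀ : EuclideanSpace ℂ (Fin d))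
    {Ω : Type*} [MeasurableSpace Ω] (P : Measure Ω) [IsProbabilityMeasure P]
    (r : ℕ → Fin K → Ω → Fin R) (hr_meas : ∀ t k, Measurable (r t k))
    (hr_indep : iIndepFun (fun (q : ℕ × Fin K) => r q.1 q.2) P)
    (hr_law : ∀ t k i, P.real {ω | r t k ω = i} = p i) :
    ∀ᵐ ω ∂P, Tendsto
      (fun t : ℕ => ‖SAF.wirtingerGrad (SAF.loss ε A y)
        (SAF.iterate ε A y blk p μ z₀ (fun s k => r s k ω) t)‖)
      atTop (𝓝 0) := by
  rw [SAF.wirtingerGrad_loss hε]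
  obtain ⟨C, hC, hg⟩ := SAF.exists_norm_stochGrad_le (K := K) hε A y blk hp_pos
  obtain ⟨D, hD, hlip⟩ := SAF.exists_norm_lossGrad_sub_le hε A y
  set B : ℝ := ∑ j, ‖SAF.row A j‖ ^ 2 with hBdef
  have hB : 0 ≤ B := Finset.sum_nonneg fun j _ => by positivity
  set Z : ℕ → Ω → EuclideanSpace ℂ (Fin d) := fun t ω =>
    SAF.iterate ε A y blk p μ z₀ (fun s k => r s k ω) t with hZdef
  set g : ℕ → Ω → EuclideanSpace ℂ (Fin d) := fun t ω =>
    SAF.stochGrad ε A y blk p (fun k => r t k ω) (Z t ω) with hgdef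
  have hZs : ∀ t ω, Z (t + 1) ω = Z t ω + -(μ t • g t ω) := fun t ω => sub_eq_add_neg _ _
  have hZmeas : ∀ t, Measurable[SAF.drawFiltration hr_meas t] (Z t) :=
    SAF.measurable_iterate hε A y blk p μ z₀ hr_meas
  have hZfin : ∀ t, (Set.range (Z t)).Finite := SAF.finite_range_iterate ε A y blk p μ z₀ r
  -- Normalising by the accumulated growth factors removes the second-order term; 1 + x ≤ exp x and
  -- ∑ μ_t² < ∞ bound `Q`.
  set Q : ℕ → ℝ := fun t => ∏ s ∈ Finset.range t, (1 + B * C ^ 2 * μ s ^ 2) with hQdef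
  have hQ1 : ∀ t, 1 ≤ Q t := fun t =>
    Finset.one_le_prod fun s _ => le_add_of_nonneg_right (by positivity)
  have hQpos : ∀ t, 0 < Q t := fun t => one_pos.trans_le (hQ1 t)
  have hQs : ∀ t, Q (t + 1) = Q t * (1 + B * C ^ 2 * μ t ^ 2) := fun t =>
    Finset.prod_range_succ _ _
  obtain ⟨q, hQq⟩ : ∃ q, ∀ t, Q t ≤ q := by
    refine ⟨Real.exp (∑' s, B * C ^ 2 * μ s ^ 2), fun t => ?_⟩
    calc Q t ≤ ∏ s ∈ Finset.range t, Real.exp (B * C ^ 2 * μ s ^ 2) :=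
          Finset.prod_le_prod (fun s _ => by positivity) fun s _ => by
            rw [add_comm]; exact Real.add_one_le_exp _
      _ = Real.exp (∑ s ∈ Finset.range t, B * C ^ 2 * μ s ^ 2) := (Real.exp_sum _ _).symm
      _ ≤ _ := Real.exp_le_exp.2
          ((hμ_sq.mul_left (B * C ^ 2)).sum_le_tsum _ fun s _ => by positivity)
  have hdescent : ∀ t ω, SAF.loss ε A y (Z (t + 1) ω) / Q (t + 1) ≤
      SAF.loss ε A y (Z t ω) / Q t - 2 * μ t / Q (t + 1) *
        (inner ℂ (SAF.lossGrad ε A y (Z t ω)) (g t ω)).re := by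
    intro t ω
    have h1 := SAF.loss_add_le hε A y (Z t ω) (-(μ t • g t ω))
    rw [← hZs, inner_neg_right, inner_smul_right_eq_smul, Complex.neg_re, Complex.smul_re,
      smul_eq_mul, norm_neg, norm_smul, Real.norm_of_nonneg (hμ_pos t).le] at h1
    have h2 : ‖g t ω‖ ^ 2 ≤ C ^ 2 * SAF.loss ε A y (Z t ω) := by
      have := pow_le_pow_left₀ (norm_nonneg _) (hg (fun k => r t k ω) (Z t ω)) 2
      rwa [mul_pow, Real.sq_sqrt (SAF.loss_nonneg _ _ _ _)] at this
    have h3 : B * (μ t * ‖g t ω‖) ^ 2 ≤ B * (μ t ^ 2 * (C ^ 2 * SAF.loss ε A y (Z t ω))) := by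
      rw [mul_pow]
      gcongr
    have h4 : SAF.loss ε A y (Z t ω) / Q t
        = SAF.loss ε A y (Z t ω) * (1 + B * C ^ 2 * μ t ^ 2) / Q (t + 1) := by
      have : 0 < 1 + B * C ^ 2 * μ t ^ 2 := by positivity
      have := hQpos t
      rw [hQs]
      field_simp
    rw [h4, div_mul_eq_mul_div, ← sub_div]
    have := hQpos (t + 1)
    gcongr
    linarith
  have hLint : ∀ t, Integrable (fun ω => SAF.loss ε A y (Z t ω) / Q t) P := fun t =>
    (SAF.integrable_comp_of_finite_range ((hZmeas t).mono ((SAF.drawFiltration hr_meas).le t)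
      le_rfl) (hZfin t) (SAF.continuous_loss ε A y).measurable).div_const _
  have hGint : ∀ t, Integrable (fun ω => 2 * μ t / Q (t + 1) *
      ‖SAF.lossGrad ε A y (Z t ω)‖ ^ 2) P := fun t =>
    (SAF.integrable_comp_of_finite_range ((hZmeas t).mono ((SAF.drawFiltration hr_meas).le t)
      le_rfl) (hZfin t) ((SAF.continuous_lossGrad hε A y).norm.pow 2).measurable).const_mul _
  have hunb := fun t => SAF.integrable_and_setIntegral_inner_stochGrad hK hε A y blk hp_pos
    ((SAF.drawFiltration hr_meas).le t) (hr_meas t)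
    (SAF.indep_drawFiltration hr_meas hr_indep t) (hr_law t) (hZmeas t) (hZfin t)
  have hgint : ∀ t, Integrable (fun ω =>
      (inner ℂ (SAF.lossGrad ε A y (Z t ω)) (g t ω)).re) P := fun t => (hunb t).1
  have hRS := SAF.ae_tendsto_and_summable (P := P) (ℱ := SAF.drawFiltration hr_meas)
    (V := fun t ω => SAF.loss ε A y (Z t ω) / Q t)
    (X := fun t ω => 2 * μ t / Q (t + 1) * ‖SAF.lossGrad ε A y (Z t ω)‖ ^ 2)
    (fun t => (((SAF.continuous_loss ε A y).measurable.comp (hZmeas t)).div_const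
      (Q t)).stronglyMeasurable)
    (fun t ω => div_nonneg (SAF.loss_nonneg _ _ _ _) (hQpos t).le)
    (fun t ω => by
      have := hμ_pos t
      have := hQpos (t + 1)
      positivity)
    hLint hGint (by
      intro t s hs
      refine (integral_mono (hLint (t + 1)).integrableOn
        ((hLint t).sub ((hgint t).const_mul (2 * μ t / Q (t + 1)))).integrableOn
        (hdescent t)).trans_eq ?_
      simp only [Pi.sub_apply]
      rw [integral_sub (hLint t).integrableOn ((hgint t).const_mul _).integrableOn,
        integral_const_mul, integral_const_mul,
        (hunb t).2 s hs])
  filter_upwards [hRS] with ω hω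
  obtain ⟨⟨c, hc⟩, hsum⟩ := hω
  obtain ⟨b, hb⟩ := hc.bddAbove_range
  have hq : 0 < q := (hQpos 0).trans_le (hQq 0)
  -- The convergent normalised loss is bounded by `b` on this path, and `Q t ≤ q` transfers the
  -- bound to the loss.
  have hLb : ∀ t, SAF.loss ε A y (Z t ω) ≤ b * q := by
    intro t
    have h1 : SAF.loss ε A y (Z t ω) / Q t ≤ b := hb ⟨t, rfl⟩
    have hb0 : 0 ≤ b := (div_nonneg (SAF.loss_nonneg _ _ _ _) (hQpos t).le).trans h1
    exact ((div_le_iff₀ (hQpos t)).1 h1).trans (mul_le_mul_of_nonneg_left (hQq t) hb0)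
  refine SAF.tendsto_zero_of_summable_mul_sq (μ := μ) (M := D * (C * Real.sqrt (b * q)))
    (fun t => norm_nonneg _) hμ_pos (by positivity) hμ_sum ?_ ?_ fun t => ?_
  · have := hμ_sq.tendsto_atTop_zero.sqrt
    simpa [Real.sqrt_sq (hμ_pos _).le] using this
  · refine Summable.of_nonneg_of_le (fun t => mul_nonneg (hμ_pos t).le (sq_nonneg _)) (fun t => ?_)
      (hsum.mul_left (q / 2))
    -- The bound on `Q` also removes the weight 1/Q from the summable series.
    have h1 : 1 ≤ q / Q (t + 1) := (one_le_div (hQpos _)).2 (hQq _)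
    calc μ t * ‖SAF.lossGrad ε A y (Z t ω)‖ ^ 2
        ≤ q / Q (t + 1) * (μ t * ‖SAF.lossGrad ε A y (Z t ω)‖ ^ 2) :=
          le_mul_of_one_le_left (mul_nonneg (hμ_pos t).le (sq_nonneg _)) h1
      _ = _ := by ring
  · have h1 := hlip (Z (t + 1) ω) (Z t ω)
    have h2 : ‖Z (t + 1) ω - Z t ω‖ ≤ μ t * (C * Real.sqrt (b * q)) := by
      rw [hZs, add_sub_cancel_left, norm_neg, norm_smul, Real.norm_of_nonneg (hμ_pos t).le]
      have := (hμ_pos t).le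
      gcongr
      refine (hg _ _).trans ?_
      gcongr
      exact hLb t
    have h3 := norm_sub_norm_le (SAF.lossGrad ε A y (Z (t + 1) ω)) (SAF.lossGrad ε A y (Z t ω))
    have h4 := mul_le_mul_of_nonneg_left h2 hD
    change ‖SAF.lossGrad ε A y (Z (t + 1) ω)‖ ≤ ‖SAF.lossGrad ε A y (Z t ω)‖ + _
    linarith
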